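/- Let $\Omega\subset\mathbb R^N$ be open with Lebesgue measure $\lambda$ and Lebesgue $\sigma$-algebra $\mathcal A$ (on $\Omega$). Let $\mathcal P\subset\mathbb R^d$, let $\mathcal P_n\subset\mathcal P$ (interpolation nodes) and $\mathcal T\subset\mathcal P$ (training parameters) be finite, and let $\ell_\eta$, $\eta\in\mathcal P_n$, be Lagrange basis polynomials, i.e. polynomials on $\mathbb R^d$ with $\ell_\eta(\nu)=\delta_{\eta\nu}$ for $\eta,\nu\in\mathcal P_n$. Let $\Lambda_n:=\sup_{\mu\in\mathcal P}\sum_{\eta\in\mathcal P_n}|\ell_\eta(\mu)|$ be the Lebesgue constant. Let $u(\cdot,\mu)\in BV(\Omega)$ for every $\mu\in\mathcal P$, where $\|v\|_{BV(\Omega)}:=\|v\|_{L_1(\Omega)}+|Dv|(\Omega)$ and $|Dv|(\Omega):=\sup\{\int_\Omega v\,\mathrm{div}\,w\,dx : w\in C_c^1(\Omega;\mathbb R^N),\ |w|\le 1\}$. For transforms $\phi(\mu,\eta):\Omega\to\Omega$ put $$u_n(x,\mu;\phi):=\sum_{\eta\in\mathcal P_n}\ell_\eta(\mu)\,u(\phi(\mu,\eta)(x),\eta),\qquad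 \sigma_{\mathcal T}(\phi):=\sup_{\mu\in\mathcal T}\|u(\cdot,\mu)-u_n(\cdot,\mu;\phi)\|_{L_1(\Omega)} .$$ Let $\phi(\mu,\eta),\varphi(\mu,\eta):\Omega\to\Omega$ be two families of transforms and suppose that, for all $\mu\in\mathcal P$, $\eta\in\mathcal P_n$ and $0\le s\le 1$, there are maps $\Phi^s(\mu,\eta):\Omega\to\Omega$, Lebesgue measurable in $x$ for each $s$ and differentiable with respect to $s\in[0,1]$ for each $x\in\Omega$, such that $$\Phi^0(\mu,\eta)=\phi(\mu,\eta),\qquad \Phi^1(\mu,\eta)=\varphi(\mu,\eta),$$ $$\lambda\big((\Phi^s(\mu,\eta))^{-1}(A)\big)\le c\,\lambda(A)\quad\text{for all } A\in\mathcal A,\ 0\le s\le 1,$$ $$\sup_{0\le s\le1,\ x\in\Omega}|\partial_s\Phi^s(\mu,\eta)(x)|\le C\,\|\phi(\mu,\eta)-\varphi(\mu,\eta)\|_{L_\infty(\Omega)}$$ with constants $c,C\ge0$ independent of $\mu$, $\eta$. Then $\sigma_{\mathcal T}(\phi)$ and $\sigma_{\mathcal T}(\varphi)$ are finite and $$|\sigma_{\mathcal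 T}(\phi)-\sigma_{\mathcal T}(\varphi)|\le c\,C\,\Lambda_n\,\sup_{\eta\in\mathcal P_n}\|u(\cdot,\eta)\|_{BV(\Omega)}\ \sup_{\mu\in\mathcal P,\ \eta\in\mathcal P_n}\|\phi(\mu,\eta)-\varphi(\mu,\eta)\|_{L_\infty(\Omega)} .$$ Here the right-hand side is taken in $[0,\infty]$ with $0\cdot\infty=0$ and $\sup\emptyset=0$. -/

import Mathlib

open MeasureTheory Set
open scoped ENNReal NNReal

noncomputable section

namespace SnapshotInterpolation

/-- The divergence of a vector field on Euclidean space. -/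
def divergence {N : ℕ} (w : EuclideanSpace ℝ (Fin N) → EuclideanSpace ℝ (Fin N))
    (x : EuclideanSpace ℝ (Fin N)) : ℝ :=
  ∑ i, (fderiv ℝ w x (EuclideanSpace.single i 1)) i

/-- The total variation `|Dv|(Ω)`: the supremum of `∫_Ω v div w` over all `w ∈ C_c^1(Ω; ℝ^N)`
with `|w| ≤ 1` pointwise. -/
def totalVariation {N : ℕ} (Ω : Set (EuclideanSpace ℝ (Fin N)))
    (v : EuclideanSpace ℝ (Fin N) → ℝ) : ℝ≥0∞ :=
  ⨆ (w : EuclideanSpace ℝ (Fin N) → EuclideanSpace ℝ (Fin N)) (_ : ContDiff ℝ 1 w)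
    (_ : HasCompactSupport w) (_ : tsupport w ⊆ Ω) (_ : ∀ x, ‖w x‖ ≤ 1),
    ENNReal.ofReal (∫ x in Ω, v x * divergence w x)

/-- `v ∈ BV(Ω)`. -/
def MemBV {N : ℕ} (Ω : Set (EuclideanSpace ℝ (Fin N)))
    (v : EuclideanSpace ℝ (Fin N) → ℝ) : Prop :=
  IntegrableOn v Ω ∧ totalVariation Ω v < ∞

/-- The norm `‖v‖_{BV(Ω)} = ‖v‖_{L_1(Ω)} + |Dv|(Ω)`. -/
def bvNorm {N : ℕ} (Ω : Set (EuclideanSpace ℝ (Fin N)))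
    (v : EuclideanSpace ℝ (Fin N) → ℝ) : ℝ≥0∞ :=
  eLpNorm v 1 (volume.restrict Ω) + totalVariation Ω v

/-- `ℓ_η`, `η ∈ Pn`, are Lagrange basis polynomials for the finite node set `Pn ⊂ ℝ^d`:
`ℓ_η(ν) = δ_{ην}` for all nodes `η`, `ν`. -/
def IsLagrangeBasis {d : ℕ} (Pn : Finset (Fin d → ℝ))
    (ℓ : (Fin d → ℝ) → MvPolynomial (Fin d) ℝ) : Prop :=
  ∀ η ∈ Pn, ∀ ν ∈ Pn, MvPolynomial.eval ν (ℓ η) = if ν = η then 1 else 0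

/-- The Lebesgue constant `Λ_n = sup_{μ ∈ P} ∑_{η ∈ Pn} |ℓ_η(μ)|`. -/
def lebesgueConstant {d : ℕ} (P : Set (Fin d → ℝ)) (Pn : Finset (Fin d → ℝ))
    (ℓ : (Fin d → ℝ) → MvPolynomial (Fin d) ℝ) : ℝ≥0∞ :=
  ⨆ μ ∈ P, ENNReal.ofReal (∑ η ∈ Pn, |MvPolynomial.eval μ (ℓ η)|)

/-- The transformed snapshot interpolation
`u_n(x, μ; φ) = ∑_{η ∈ Pn} ℓ_η(μ) u(φ(μ, η)(x), η)`. Here `u μ` is the function `u(·, μ)`. -/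
def interpolant {d N : ℕ} (Pn : Finset (Fin d → ℝ))
    (ℓ : (Fin d → ℝ) → MvPolynomial (Fin d) ℝ)
    (u : (Fin d → ℝ) → EuclideanSpace ℝ (Fin N) → ℝ)
    (φ : (Fin d → ℝ) → (Fin d → ℝ) → EuclideanSpace ℝ (Fin N) → EuclideanSpace ℝ (Fin N))
    (μ : Fin d → ℝ) (x : EuclideanSpace ℝ (Fin N)) : ℝ :=
  ∑ η ∈ Pn, MvPolynomial.eval μ (ℓ η) * u η (φ μ η x)

/-- The training error `σ_T(φ) = sup_{μ ∈ T} ‖u(·, μ) - u_n(·, μ; φ)‖_{L_1(Ω)}`. -/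
def trainingError {d N : ℕ} (Ω : Set (EuclideanSpace ℝ (Fin N)))
    (Pn T : Finset (Fin d → ℝ)) (ℓ : (Fin d → ℝ) → MvPolynomial (Fin d) ℝ)
    (u : (Fin d → ℝ) → EuclideanSpace ℝ (Fin N) → ℝ)
    (φ : (Fin d → ℝ) → (Fin d → ℝ) → EuclideanSpace ℝ (Fin N) → EuclideanSpace ℝ (Fin N)) :
    ℝ≥0∞ :=
  ⨆ μ ∈ T, eLpNorm (fun x => u μ x - interpolant Pn ℓ u φ μ x) 1 (volume.restrict Ω)

/-- `‖f‖_{L_∞(Ω)}` (essential supremum) of a vector valued function. -/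
def supNorm {N : ℕ} (Ω : Set (EuclideanSpace ℝ (Fin N)))
    (f : EuclideanSpace ℝ (Fin N) → EuclideanSpace ℝ (Fin N)) : ℝ≥0∞ :=
  eLpNorm f ∞ (volume.restrict Ω)

end SnapshotInterpolation

end

/-! By the triangle inequality in `L_1` and the definition of the Lebesgue constant, it suffices to
bound `∫_Ω |v ∘ Φ^0 - v ∘ Φ^1|` for each snapshot `v`. For smooth `v`, integrate `|∇v|` times the
speed along `s ↦ Φ^s(x)`, then over `x`; by Tonelli and the pushforward bound the result is at most
`c M ∫_Ω |∇v|`, with `M` bounding the speed.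

For `v ∈ BV` this is applied to mollifications `V_n`. Mollification does not increase variation on a
compact set whose thickening stays in `Ω` (`lintegral_enorm_fderiv_convolution_le_totalVariation`).
Each trajectory is compact in `Ω`, so it eventually lies in the `n`-th set of a compact exhaustion,
and Fatou's lemma gives the limit (`lintegral_enorm_comp_sub_comp_le`). The pushforward bound also
makes compositions integrable, whence the errors are finite. -/

namespace SnapshotInterpolation

open Filter Topology
open scoped Convolution

/-! ### Mollification and total variation -/

section Mollification

variable {E F : Type*} [NormedAddCommGroup E] [InnerProductSpace ℝ E] [FiniteDimensional ℝ E]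
  [MeasurableSpace E] [BorelSpace E] [NormedAddCommGroup F] [NormedSpace ℝ F]

theorem integrable_fderiv_smul {ρ : E → ℝ} (hρ : ContDiff ℝ 1 ρ) (hc : HasCompactSupport ρ)
    {g : E → F} (hg : LocallyIntegrable g volume) (x e : E) :
    Integrable fun t => fderiv ℝ ρ (x - t) e • g t := by
  have h : Continuous fun y => fderiv ℝ ρ y e :=
    (hρ.continuous_fderiv one_ne_zero).clm_apply continuous_const
  have hs : HasCompactSupport fun y => fderiv ℝ ρ y e := hc.fderiv_apply (𝕜 := ℝ) e
  exact (hs.convolutionExists_left (ContinuousLinearMap.lsmul ℝ ℝ) h hg x).integrable_swap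

theorem fderiv_convolution_apply {ρ : E → ℝ} (hρ : ContDiff ℝ 1 ρ) (hc : HasCompactSupport ρ)
    {g : E → F} (hg : LocallyIntegrable g volume) (x e : E) :
    fderiv ℝ (ρ ⋆[ContinuousLinearMap.lsmul ℝ ℝ, volume] g) x e
      = ∫ t, fderiv ℝ ρ (x - t) e • g t := by
  rw [(hc.hasFDerivAt_convolution_left (ContinuousLinearMap.lsmul ℝ ℝ) hρ hg x).fderiv,
    convolution_eq_swap, ContinuousLinearMap.integral_apply]
  · rfl
  · exact ((hc.fderiv ℝ).convolutionExists_left _ (hρ.continuous_fderiv one_ne_zero) hg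
      x).integrable_swap

theorem norm_convolution_le_one {ρ : E → ℝ} (hρ0 : ∀ x, 0 ≤ ρ x) (hρi : Integrable ρ)
    (hρ1 : ∫ x, ρ x = 1) {g : E → F} (hg : ∀ x, ‖g x‖ ≤ 1) (x : E) :
    ‖(ρ ⋆[ContinuousLinearMap.lsmul ℝ ℝ, volume] g) x‖ ≤ 1 := by
  rw [convolution_eq_swap]
  calc _ ≤ ∫ t, ρ (x - t) := by
        refine norm_integral_le_of_norm_le (hρi.comp_sub_left x) (.of_forall fun t => ?_)
        simp only [ContinuousLinearMap.lsmul_apply, norm_smul, Real.norm_of_nonneg (hρ0 _)]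
        exact mul_le_of_le_one_right (hρ0 _) (hg t)
    _ = 1 := by rw [integral_sub_left_eq_self ρ volume x, hρ1]

end Mollification

variable {N : ℕ}

theorem divergence_convolution {ρ : EuclideanSpace ℝ (Fin N) → ℝ} (hρ : ContDiff ℝ 1 ρ)
    (hc : HasCompactSupport ρ) {w : EuclideanSpace ℝ (Fin N) → EuclideanSpace ℝ (Fin N)}
    (hw : LocallyIntegrable w volume) (y : EuclideanSpace ℝ (Fin N)) :
    divergence (ρ ⋆[ContinuousLinearMap.lsmul ℝ ℝ, volume] w) y
      = ∫ t, fderiv ℝ ρ (y - t) (w t) := by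
  have hi (i : Fin N) := integrable_fderiv_smul hρ hc hw y (EuclideanSpace.single i 1)
  have h (i : Fin N) : (fderiv ℝ (ρ ⋆[ContinuousLinearMap.lsmul ℝ ℝ, volume] w) y
      (EuclideanSpace.single i 1)) i
      = ∫ t, fderiv ℝ ρ (y - t) (EuclideanSpace.single i 1) * w t i := by
    rw [fderiv_convolution_apply hρ hc hw]
    exact ((EuclideanSpace.proj i : EuclideanSpace ℝ (Fin N) →L[ℝ] ℝ).integral_comp_comm
      (hi i)).symm
  simp only [divergence, h]
  rw [← integral_finsetSum]
  · refine integral_congr_ae (.of_forall fun t => ?_)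
    have hwt : w t = ∑ i, w t i • EuclideanSpace.single i (1 : ℝ) := by
      ext j
      simp [Finset.sum_apply, Pi.single_apply]
    calc _ = fderiv ℝ ρ (y - t) (∑ i, w t i • EuclideanSpace.single i (1 : ℝ)) := by
          simp [mul_comm]
      _ = _ := by rw [← hwt]
  · exact fun i _ => (EuclideanSpace.proj i : EuclideanSpace ℝ (Fin N) →L[ℝ] ℝ).integrable_comp
      (hi i)

/-- Integration by parts by Fubini: the derivative falls on the kernel, and since the kernel is even
its derivative is odd, which produces the sign. Neither `v` nor `w` needs to be smooth. -/
theorem integral_mul_divergence_convolution {ρ v : EuclideanSpace ℝ (Fin N) → ℝ}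
    (hρ : ContDiff ℝ 1 ρ) (hc : HasCompactSupport ρ) (heven : ∀ x, ρ (-x) = ρ x)
    (hv : Integrable v) {w : EuclideanSpace ℝ (Fin N) → EuclideanSpace ℝ (Fin N)}
    (hw : Integrable w) :
    ∫ y, v y * divergence (ρ ⋆[ContinuousLinearMap.lsmul ℝ ℝ, volume] w) y
      = -∫ x, fderiv ℝ (ρ ⋆[ContinuousLinearMap.lsmul ℝ ℝ, volume] v) x (w x) := by
  have hcont := hρ.continuous_fderiv one_ne_zero
  obtain ⟨B, hB⟩ := (hc.fderiv ℝ).exists_bound_of_continuous hcont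
  have hodd (z) : fderiv ℝ ρ (-z) = -fderiv ℝ ρ z := by
    have h := ((hρ.differentiable one_ne_zero (-z)).hasFDerivAt.comp z
      (hasFDerivAt_id z).neg).fderiv
    simp only [Function.comp_def, heven] at h
    ext e
    simp [h]
  simp only [divergence_convolution hρ hc hw.locallyIntegrable, ← integral_const_mul]
  rw [integral_integral_swap, ← integral_neg]
  · refine integral_congr_ae (.of_forall fun x => ?_)
    simp only [fderiv_convolution_apply hρ hc hv.locallyIntegrable, ← integral_neg]
    refine integral_congr_ae (.of_forall fun y => ?_)
    have := hodd (x - y)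
    rw [neg_sub] at this
    simp [this, mul_comm]
  -- Fubini is justified by the integrable majorant `B |v(y)| |w(x)|`, with `B` bounding the
  -- derivative of the kernel.
  · refine ((hv.norm.mul_prod hw.norm).mul_const B).mono' ?_ (.of_forall fun z => ?_)
    · refine hv.aestronglyMeasurable.comp_fst.mul ?_
      exact isBoundedBilinearMap_apply.continuous.comp_aestronglyMeasurable
        ((hcont.comp (continuous_fst.sub continuous_snd)).aestronglyMeasurable.prodMk
          hw.aestronglyMeasurable.comp_snd)
    · simp only [Function.uncurry, norm_mul]
      calc _ ≤ ‖v z.1‖ * (B * ‖w z.2‖) := by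
            gcongr
            exact (ContinuousLinearMap.le_opNorm _ _).trans (by gcongr; exact hB _)
        _ = _ := by ring

/-- Duality: test against the direction of `-∇V` cut off to `K`. Mollifying that field with the same
kernel makes it admissible, and the pairing with `v` becomes `∫_K |∇V|`. -/
theorem lintegral_enorm_fderiv_convolution_le_totalVariation
    {Ω K : Set (EuclideanSpace ℝ (Fin N))} (hΩ : MeasurableSet Ω)
    {v : EuclideanSpace ℝ (Fin N) → ℝ} (hv : IntegrableOn v Ω)
    (ρ : ContDiffBump (0 : EuclideanSpace ℝ (Fin N))) (hK : IsCompact K)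
    (hKΩ : Metric.cthickening ρ.rOut K ⊆ Ω) :
    ∫⁻ x in K, ‖fderiv ℝ (ρ.normed volume ⋆[ContinuousLinearMap.lsmul ℝ ℝ, volume]
      Ω.indicator v) x‖ₑ ≤ totalVariation Ω v := by
  have hvi : Integrable (Ω.indicator v) := hv.integrable_indicator hΩ
  set r := ρ.normed volume
  have hr : ContDiff ℝ 1 r := ρ.contDiff_normed
  have hrc : HasCompactSupport r := ρ.hasCompactSupport_normed
  set V := r ⋆[ContinuousLinearMap.lsmul ℝ ℝ, volume] Ω.indicator v
  have hV : ContDiff ℝ 1 V :=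
    hrc.contDiff_convolution_left _ hr hvi.locallyIntegrable
  have hVc : Continuous (fderiv ℝ V) := hV.continuous_fderiv one_ne_zero
  have hG : Continuous (gradient V) :=
    (InnerProductSpace.toDual ℝ _).symm.continuous.comp hVc
  have hGn (x) : ‖gradient V x‖ = ‖fderiv ℝ V x‖ := LinearIsometryEquiv.norm_map _ _
  -- At critical points `0⁻¹ = 0` makes the field vanish, so no case is lost.
  set w : EuclideanSpace ℝ (Fin N) → EuclideanSpace ℝ (Fin N) :=
    K.indicator fun x => -(‖gradient V x‖⁻¹ • gradient V x)
  have hwm : Measurable w :=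
    ((hG.norm.measurable.inv.smul hG.measurable).neg).indicator hK.measurableSet
  have hw1 (x) : ‖w x‖ ≤ 1 := by
    simp only [w, indicator]
    split_ifs
    · rw [norm_neg, norm_smul, norm_inv, norm_norm]
      exact inv_mul_le_one
    · simp
  have hwi : Integrable w := by
    refine ((integrable_indicator_iff hK.measurableSet).2 (integrableOn_const (C := (1 : ℝ))
      hK.measure_lt_top.ne)).mono' hwm.aestronglyMeasurable (.of_forall fun x => ?_)
    by_cases hx : x ∈ K
    · simpa [hx] using hw1 x
    · simp [w, hx]
  have hfw (x) : fderiv ℝ V x (w x) = K.indicator (fun x => -‖fderiv ℝ V x‖) x := by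
    by_cases hx : x ∈ K
    · have : fderiv ℝ V x (gradient V x) = ‖gradient V x‖ ^ 2 := by
        rw [← real_inner_self_eq_norm_sq]
        exact (InnerProductSpace.toDual_symm_apply (𝕜 := ℝ)).symm
      simp only [w, hx, indicator_of_mem, map_neg, map_smul, this, ← hGn, smul_eq_mul]
      rcases eq_or_ne ‖gradient V x‖ 0 with h | h
      · simp [h]
      · field_simp
    · simp [w, hx]
  have hsupp : Function.support (r ⋆[ContinuousLinearMap.lsmul ℝ ℝ, volume] w)
      ⊆ Metric.cthickening ρ.rOut K := by
    refine (support_convolution_subset _).trans ?_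
    rintro _ ⟨a, ha, b, hb, rfl⟩
    have hbK : b ∈ K := by
      by_contra h
      exact hb (by simp [w, h])
    rw [ρ.support_normed_eq, mem_ball_zero_iff] at ha
    exact Metric.mem_cthickening_of_dist_le (a + b) b _ K hbK (by simpa using ha.le)
  have htsupp : tsupport (r ⋆[ContinuousLinearMap.lsmul ℝ ℝ, volume] w)
      ⊆ Metric.cthickening ρ.rOut K :=
    closure_minimal hsupp Metric.isClosed_cthickening
  have key : ∫ x in Ω, v x * divergence (r ⋆[ContinuousLinearMap.lsmul ℝ ℝ, volume] w) x
      = ∫ x in K, ‖fderiv ℝ V x‖ := by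
    have h := integral_mul_divergence_convolution hr hrc ρ.normed_neg hvi hwi
    simp only [hfw, integral_indicator hK.measurableSet, integral_neg, neg_neg,
      V] at h
    rw [← h, ← integral_indicator hΩ]
    refine integral_congr_ae (.of_forall fun x => ?_)
    by_cases hx : x ∈ Ω <;> simp [hx]
  have hint : IntegrableOn (fderiv ℝ V) K := hVc.continuousOn.integrableOn_compact hK
  rw [← ofReal_integral_norm_eq_lintegral_enorm hint, ← key]
  exact le_iSup_of_le _ (le_iSup_of_le
    (hrc.contDiff_convolution_left _ hr hwi.locallyIntegrable) (le_iSup_of_le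
    (HasCompactSupport.of_support_subset_isCompact hK.cthickening hsupp) (le_iSup_of_le
    (htsupp.trans hKΩ) (le_iSup_of_le (norm_convolution_le_one ρ.nonneg_normed
      ρ.integrable_normed ρ.integral_normed hw1) le_rfl))))

/-! ### Trajectories: mean value bound, joint measurability, exhaustion -/

/-- The derivative of `γ` need not be integrable, so the fundamental theorem of calculus is replaced
by a comparison with the primitive of the continuous function `M |f'(γ)|`. -/
theorem enorm_sub_le_lintegral_enorm_fderiv {E : Type*} [NormedAddCommGroup E] [NormedSpace ℝ E]
    {f : E → ℝ} (hf : ContDiff ℝ 1 f) {γ : ℝ → E} (hγ : DifferentiableOn ℝ γ (Icc 0 1))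
    {M : ℝ≥0} (hM : ∀ s ∈ Icc (0 : ℝ) 1, ‖derivWithin γ (Icc 0 1) s‖ₑ ≤ M) :
    ‖f (γ 1) - f (γ 0)‖ₑ ≤ M * ∫⁻ s in Icc (0 : ℝ) 1, ‖fderiv ℝ f (γ s)‖ₑ := by
  -- Clamping `s` to `[0,1]` makes `b` continuous on all of `ℝ`, hence its primitive differentiable
  -- everywhere.
  set b : ℝ → ℝ := fun s => ‖fderiv ℝ f (γ (projIcc 0 1 zero_le_one s))‖
  have hb : Continuous b := ((hf.continuous_fderiv one_ne_zero).comp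
    (hγ.continuousOn.domRestrict.comp continuous_projIcc)).norm
  have hbγ {s : ℝ} (hs : s ∈ Icc (0 : ℝ) 1) : b s = ‖fderiv ℝ f (γ s)‖ := by
    simp only [b, projIcc_of_mem zero_le_one hs]
  have hderiv : ∀ s ∈ Ico (0 : ℝ) 1, HasDerivWithinAt (fun t => f (γ t) - f (γ 0))
      (fderiv ℝ f (γ s) (derivWithin γ (Icc 0 1) s)) (Ici s) s := by
    intro s hs
    have h := ((hf.differentiable one_ne_zero (γ s)).hasFDerivAt.comp_hasDerivWithinAt s
      (hγ s (Ico_subset_Icc_self hs)).hasDerivWithinAt).sub_const (f (γ 0))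
    exact h.mono_of_mem_nhdsWithin
      (mem_of_superset (Icc_mem_nhdsGE hs.2) (Icc_subset_Icc_left hs.1))
  have main := image_norm_le_of_norm_deriv_right_le_deriv_boundary
    (f := fun t => f (γ t) - f (γ 0)) (B := fun t => M * ∫ s in (0 : ℝ)..t, b s)
    (B' := fun s => M * b s)
    ((hf.continuous.comp_continuousOn hγ.continuousOn).sub continuousOn_const) hderiv
    (by simp) (fun s => (hb.integral_hasStrictDerivAt 0 s).hasDerivAt.const_mul _)
    (fun s hs => by
      have hs' := Ico_subset_Icc_self hs
      have h1 : ‖derivWithin γ (Icc 0 1) s‖ ≤ M := by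
        have := hM s hs'
        rwa [enorm_eq_nnnorm, ENNReal.coe_le_coe] at this
      rw [hbγ hs', mul_comm]
      exact (ContinuousLinearMap.le_opNorm _ _).trans (by gcongr))
    (right_mem_Icc.2 zero_le_one)
  have hint : ENNReal.ofReal (∫ s in (0 : ℝ)..1, b s)
      = ∫⁻ s in Icc (0 : ℝ) 1, ‖fderiv ℝ f (γ s)‖ₑ := by
    rw [intervalIntegral.integral_of_le zero_le_one, ← integral_Icc_eq_integral_Ioc,
      ofReal_integral_eq_lintegral_ofReal (hb.continuousOn.integrableOn_compact isCompact_Icc)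
        (.of_forall fun _ => norm_nonneg _)]
    refine setLIntegral_congr_fun measurableSet_Icc fun s hs => ?_
    simp only [hbγ hs, ofReal_norm]
  rw [← hint, ← ENNReal.ofReal_coe_nnreal, ← ENNReal.ofReal_mul M.coe_nonneg, ← ofReal_norm]
  exact ENNReal.ofReal_le_ofReal main

/-- Carathéodory argument: `F` is the a.e. limit of functions piecewise constant in `s`, sampled at
`⌊s(n+1)⌋/(n+1)`. -/
theorem aemeasurable_uncurry_of_continuousOn {X Y : Type*} [MeasurableSpace X]
    [TopologicalSpace Y] [TopologicalSpace.PseudoMetrizableSpace Y] [MeasurableSpace Y]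
    [BorelSpace Y] {μ : Measure X} [SFinite μ] {F : ℝ → X → Y}
    (hF : ∀ s ∈ Icc (0 : ℝ) 1, AEMeasurable (F s) μ)
    (hc : ∀ᵐ x ∂μ, ContinuousOn (fun s => F s x) (Icc 0 1)) :
    AEMeasurable (Function.uncurry F) ((volume.restrict (Icc (0 : ℝ) 1)).prod μ) := by
  set ν := (volume.restrict (Icc (0 : ℝ) 1)).prod μ
  set q : ℕ → ℕ → ℝ := fun n j => min (j / ((n : ℝ) + 1)) 1
  have hq (n j) : q n j ∈ Icc (0 : ℝ) 1 := ⟨by positivity, min_le_right _ _⟩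
  set r : ℕ → ℝ → ℕ := fun n s => ⌊s * ((n : ℝ) + 1)⌋₊
  have hr (n) : Measurable (r n) := Nat.measurable_floor.comp (measurable_id.mul_const _)
  refine aemeasurable_of_tendsto_metrizable_ae (u := atTop)
    (f := fun n p => F (q n (r n p.1)) p.2) (fun n => ?_) ?_
  · have hU : (⋃ j, {p : ℝ × X | r n p.1 = j}) = univ := by
      ext p
      simp
    rw [← Measure.restrict_univ (μ := ν), ← hU, aemeasurable_iUnion_iff]
    intro j
    have hm : MeasurableSet {p : ℝ × X | r n p.1 = j} :=
      ((hr n).comp measurable_fst) (measurableSet_singleton j)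
    refine ((hF (q n j) (hq n j)).comp_snd (μ := volume.restrict (Icc (0 : ℝ) 1))).restrict.congr ?_
    filter_upwards [ae_restrict_mem hm] with p hp
    rw [show r n p.1 = j from hp]
  · filter_upwards [Measure.quasiMeasurePreserving_fst.ae (ae_restrict_mem measurableSet_Icc),
      Measure.quasiMeasurePreserving_snd.ae hc] with p hp1 hp2
    have hlim : Tendsto (fun n => q n (r n p.1)) atTop (𝓝 p.1) := by
      have h := ((tendsto_nat_floor_mul_div_atTop hp1.1).comp
        (tendsto_atTop_add_const_right atTop (1 : ℝ) tendsto_natCast_atTop_atTop)).min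
        (tendsto_const_nhds (x := (1 : ℝ)))
      rwa [min_eq_left hp1.2] at h
    exact (hp2 p.1 hp1).tendsto.comp
      (tendsto_nhdsWithin_iff.2 ⟨hlim, .of_forall fun n => hq _ _⟩)

theorem exists_compact_exhaustion {E : Type*} [PseudoMetricSpace E] [ProperSpace E] {Ω : Set E}
    (hΩ : IsOpen Ω) : ∃ K : ℕ → Set E, (∀ n, IsCompact (K n)) ∧ (∀ n, K n ⊆ Ω) ∧
      ∀ Γ ⊆ Ω, IsCompact Γ → ∀ᶠ n in atTop, Γ ⊆ K n := by
  have := hΩ.locallyCompactSpace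
  let K := CompactExhaustion.choice Ω
  refine ⟨fun n => Subtype.val '' K n, fun n => (K.isCompact n).image continuous_subtype_val,
    fun n => by simp, fun Γ hΓ hc => ?_⟩
  obtain ⟨n, hn⟩ := K.exists_superset_of_isCompact (Subtype.isCompact_iff.2
    (by rwa [Subtype.image_preimage_coe, inter_eq_right.2 hΓ]) :
    IsCompact (Subtype.val ⁻¹' Γ : Set Ω))
  filter_upwards [eventually_ge_atTop n] with m hm x hx
  exact ⟨⟨x, hΓ hx⟩, K.subset hm (hn hx), rfl⟩

/-! ### Consequences of the pushforward bound -/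

section Pushforward

variable {X : Type*} [MeasurableSpace X] {μ : Measure X} {c : ℝ≥0} {f : X → X}

theorem map_restrict_le {Ω : Set X} (hΩ : MeasurableSet Ω) (hf : AEMeasurable f (μ.restrict Ω))
    (hmaps : MapsTo f Ω Ω)
    (hpush : ∀ A ⊆ Ω, NullMeasurableSet A μ → μ (Ω ∩ f ⁻¹' A) ≤ c * μ A) :
    (μ.restrict Ω).map f ≤ c • μ.restrict Ω := by
  refine Measure.le_iff.2 fun A hA => ?_
  rw [Measure.map_apply_of_aemeasurable hf hA, Measure.restrict_apply' hΩ, Measure.smul_apply,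
    Measure.restrict_apply hA]
  refine (measure_mono fun x hx => ?_).trans
    (hpush (A ∩ Ω) inter_subset_right (hA.inter hΩ).nullMeasurableSet)
  exact ⟨hx.2, hx.1, hmaps hx.2⟩

theorem map_absolutelyContinuous (h : μ.map f ≤ c • μ) : μ.map f ≪ μ :=
  (Measure.absolutelyContinuous_of_le h).trans (Measure.smul_absolutelyContinuous)

theorem lintegral_comp_le (hf : AEMeasurable f μ) (h : μ.map f ≤ c • μ) {g : X → ℝ≥0∞}
    (hg : AEMeasurable g μ) : ∫⁻ x, g (f x) ∂μ ≤ c * ∫⁻ x, g x ∂μ := by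
  rw [← lintegral_map' (hg.mono_ac (map_absolutelyContinuous h)) hf]
  exact (lintegral_mono' h le_rfl).trans (by rw [lintegral_smul_measure]; rfl)

end Pushforward

/-! ### The BV estimate along a path of transforms -/

theorem lintegral_enorm_comp_sub_comp_le {Ω : Set (EuclideanSpace ℝ (Fin N))} (hΩ : IsOpen Ω)
    {v : EuclideanSpace ℝ (Fin N) → ℝ} (hv : IntegrableOn v Ω) {c M : ℝ≥0}
    {Φ : ℝ → EuclideanSpace ℝ (Fin N) → EuclideanSpace ℝ (Fin N)}
    (hmaps : ∀ s ∈ Icc (0 : ℝ) 1, MapsTo (Φ s) Ω Ω)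
    (hmeas : ∀ s ∈ Icc (0 : ℝ) 1, AEMeasurable (Φ s) (volume.restrict Ω))
    (hdiff : ∀ x ∈ Ω, DifferentiableOn ℝ (fun s => Φ s x) (Icc (0 : ℝ) 1))
    (hpush : ∀ s ∈ Icc (0 : ℝ) 1, (volume.restrict Ω).map (Φ s) ≤ c • volume.restrict Ω)
    (hspeed : ∀ s ∈ Icc (0 : ℝ) 1, ∀ x ∈ Ω,
      ‖derivWithin (fun t => Φ t x) (Icc (0 : ℝ) 1) s‖ₑ ≤ M) :
    ∫⁻ x in Ω, ‖v (Φ 0 x) - v (Φ 1 x)‖ₑ ≤ c * M * totalVariation Ω v := by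
  have h0 : (0 : ℝ) ∈ Icc (0 : ℝ) 1 := left_mem_Icc.2 zero_le_one
  have h1 : (1 : ℝ) ∈ Icc (0 : ℝ) 1 := right_mem_Icc.2 zero_le_one
  obtain ⟨K, hK, hKΩ, hex⟩ := exists_compact_exhaustion hΩ
  choose δ hδ hδΩ using fun n => (hK n).exists_cthickening_subset_open hΩ (hKΩ n)
  -- `δ n` keeps the thickening of `K n` inside `Ω`; the other term forces the radii to zero.
  set ε : ℕ → ℝ := fun n => min (δ n) (1 / ((n : ℝ) + 1))
  have hε (n) : 0 < ε n := lt_min (hδ n) (by positivity)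
  let ρ (n : ℕ) : ContDiffBump (0 : EuclideanSpace ℝ (Fin N)) :=
    ⟨ε n / 2, ε n, half_pos (hε n), half_lt_self (hε n)⟩
  have hvi : Integrable (Ω.indicator v) := hv.integrable_indicator hΩ.measurableSet
  set V : ℕ → EuclideanSpace ℝ (Fin N) → ℝ := fun n =>
    (ρ n).normed volume ⋆[ContinuousLinearMap.lsmul ℝ ℝ, volume] Ω.indicator v
  have hV (n) : ContDiff ℝ 1 (V n) := (ρ n).hasCompactSupport_normed.contDiff_convolution_left _
    (ρ n).contDiff_normed hvi.locallyIntegrable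
  set G : ℕ → EuclideanSpace ℝ (Fin N) → ℝ≥0∞ := fun n =>
    (K n).indicator fun y => ‖fderiv ℝ (V n) y‖ₑ
  have hG (n) : Measurable (G n) :=
    ((hV n).continuous_fderiv one_ne_zero).enorm.measurable.indicator (hK n).measurableSet
  have hGint (n) : ∫⁻ x in Ω, G n x ≤ totalVariation Ω v := by
    refine (setLIntegral_le_lintegral _ _).trans ?_
    rw [lintegral_indicator (hK n).measurableSet]
    exact lintegral_enorm_fderiv_convolution_le_totalVariation hΩ.measurableSet hv (ρ n) (hK n)
      ((Metric.cthickening_mono (min_le_left _ _) _).trans (hδΩ n))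
  have hlim : ∀ᵐ x ∂(volume.restrict Ω), Tendsto (fun n => V n x) atTop (𝓝 (v x)) := by
    have hε0 : Tendsto (fun n => (ρ n).rOut) atTop (𝓝 0) :=
      squeeze_zero (fun n => (hε n).le) (fun n => min_le_right _ _)
        tendsto_one_div_add_atTop_nhds_zero_nat
    have h := ContDiffBump.ae_convolution_tendsto_right_of_locallyIntegrable (μ := volume)
      (K := 2) hε0 (.of_forall fun n => by simp only [ρ]; linarith) hvi.locallyIntegrable
    filter_upwards [ae_restrict_of_ae h, ae_restrict_mem hΩ.measurableSet] with x hx hxΩ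
    rwa [indicator_of_mem hxΩ] at hx
  -- The pushforward bound makes preimages of null sets null, so a.e. convergence survives
  -- composition with `Φ s`.
  have hlims (s) (hs : s ∈ Icc (0 : ℝ) 1) :
      ∀ᵐ x ∂(volume.restrict Ω), Tendsto (fun n => V n (Φ s x)) atTop (𝓝 (v (Φ s x))) :=
    ae_of_ae_map (hmeas s hs) ((map_absolutelyContinuous (hpush s hs)).ae_le hlim)
  have hjoint : AEMeasurable (Function.uncurry Φ)
      ((volume.restrict (Icc (0 : ℝ) 1)).prod (volume.restrict Ω)) :=
    aemeasurable_uncurry_of_continuousOn hmeas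
      ((ae_restrict_mem hΩ.measurableSet).mono fun x hx => (hdiff x hx).continuousOn)
  have hGΦ (n) : AEMeasurable (Function.uncurry fun s x => G n (Φ s x))
      ((volume.restrict (Icc (0 : ℝ) 1)).prod (volume.restrict Ω)) :=
    (hG n).comp_aemeasurable hjoint
  calc ∫⁻ x in Ω, ‖v (Φ 0 x) - v (Φ 1 x)‖ₑ
      ≤ ∫⁻ x in Ω, liminf (fun n => M * ∫⁻ s in Icc (0 : ℝ) 1, G n (Φ s x)) atTop := by
        refine lintegral_mono_ae ?_
        filter_upwards [hlims 0 h0, hlims 1 h1, ae_restrict_mem hΩ.measurableSet]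
          with x hx0 hx1 hxΩ
        rw [enorm_sub_rev, ← (hx1.sub hx0).enorm.liminf_eq]
        refine liminf_le_liminf ?_
        filter_upwards [hex ((fun s => Φ s x) '' Icc 0 1) (by
            rintro _ ⟨s, hs, rfl⟩
            exact hmaps s hs hxΩ)
          (isCompact_Icc.image_of_continuousOn (hdiff x hxΩ).continuousOn)] with n hn
        refine (enorm_sub_le_lintegral_enorm_fderiv (hV n) (hdiff x hxΩ)
          fun s hs => hspeed s hs x hxΩ).trans_eq ?_
        congr 1
        refine setLIntegral_congr_fun measurableSet_Icc fun s hs => ?_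
        simp only [G, indicator_of_mem (hn (mem_image_of_mem _ hs))]
    _ ≤ liminf (fun n => ∫⁻ x in Ω, M * ∫⁻ s in Icc (0 : ℝ) 1, G n (Φ s x)) atTop :=
        lintegral_liminf_le' fun n => (hGΦ n).lintegral_prod_left'.const_mul _
    _ ≤ liminf (fun _ : ℕ => c * M * totalVariation Ω v) atTop := by
        refine liminf_le_liminf (.of_forall fun n => ?_)
        rw [lintegral_const_mul' _ _ ENNReal.coe_ne_top, ← lintegral_lintegral_swap (hGΦ n)]
        calc _ ≤ (M : ℝ≥0∞) * ∫⁻ _ in Icc (0 : ℝ) 1, c * totalVariation Ω v := by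
              gcongr 1
              refine setLIntegral_mono' measurableSet_Icc fun s hs => ?_
              exact (lintegral_comp_le (hmeas s hs) (hpush s hs) (hG n).aemeasurable).trans
                (by gcongr; exact hGint n)
          _ = _ := by simp; ring
    _ = _ := by simp

theorem ofReal_abs_toReal_sub_toReal_le {a b r : ℝ≥0∞} (ha : a ≠ ∞) (hb : b ≠ ∞)
    (hab : a ≤ b + r) (hba : b ≤ a + r) : ENNReal.ofReal |a.toReal - b.toReal| ≤ r := by
  induction r with
  | top => exact le_top
  | coe r =>
    lift a to ℝ≥0 using ha
    lift b to ℝ≥0 using hb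
    refine ENNReal.ofReal_le_of_le_toReal (abs_sub_le_iff.2 ?_)
    norm_cast at hab hba
    have h1 : (a : ℝ) ≤ b + r := mod_cast hab
    have h2 : (b : ℝ) ≤ a + r := mod_cast hba
    simp only [ENNReal.coe_toReal]
    constructor <;> linarith

theorem integrable_comp_of_map_le {X : Type*} [MeasurableSpace X] {μ : Measure X} {c : ℝ≥0}
    {f : X → X} (hf : AEMeasurable f μ) (h : μ.map f ≤ c • μ) {g : X → ℝ} (hg : Integrable g μ) :
    Integrable (fun x => g (f x)) μ :=
  ((hg.smul_measure_nnreal (c := c)).mono_measure h).comp_aemeasurable hf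

/-- The total variation alone suffices for finite `L`. The `L_1` part of the norm serves the case `L
= ∞`: under `0 * ∞ = 0`, either `c = 0` or `v = 0` a.e. makes both compositions vanish a.e. -/
theorem lintegral_enorm_comp_sub_comp_le_bvNorm {Ω : Set (EuclideanSpace ℝ (Fin N))}
    (hΩ : IsOpen Ω) {v : EuclideanSpace ℝ (Fin N) → ℝ} (hv : IntegrableOn v Ω) {c : ℝ≥0}
    {L : ℝ≥0∞} {Φ : ℝ → EuclideanSpace ℝ (Fin N) → EuclideanSpace ℝ (Fin N)}
    (hmaps : ∀ s ∈ Icc (0 : ℝ) 1, MapsTo (Φ s) Ω Ω)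
    (hmeas : ∀ s ∈ Icc (0 : ℝ) 1, AEMeasurable (Φ s) (volume.restrict Ω))
    (hdiff : ∀ x ∈ Ω, DifferentiableOn ℝ (fun s => Φ s x) (Icc (0 : ℝ) 1))
    (hpush : ∀ s ∈ Icc (0 : ℝ) 1, (volume.restrict Ω).map (Φ s) ≤ c • volume.restrict Ω)
    (hspeed : ∀ s ∈ Icc (0 : ℝ) 1, ∀ x ∈ Ω,
      ‖derivWithin (fun t => Φ t x) (Icc (0 : ℝ) 1) s‖ₑ ≤ L) :
    ∫⁻ x in Ω, ‖v (Φ 0 x) - v (Φ 1 x)‖ₑ ≤ c * L * bvNorm Ω v := by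
  rcases eq_or_ne L ∞ with rfl | hL
  · rcases eq_or_ne (c * bvNorm Ω v) 0 with h | h
    · have hle (s) (hs : s ∈ Icc (0 : ℝ) 1) : ∫⁻ x in Ω, ‖v (Φ s x)‖ₑ ≤ 0 := by
        refine (lintegral_comp_le (hmeas s hs) (hpush s hs) hv.1.enorm).trans ?_
        rw [← h, ← eLpNorm_one_eq_lintegral_enorm]
        gcongr
        exact le_self_add
      have h0 : (0 : ℝ) ∈ Icc (0 : ℝ) 1 := left_mem_Icc.2 zero_le_one
      have h1 : (1 : ℝ) ∈ Icc (0 : ℝ) 1 := right_mem_Icc.2 zero_le_one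
      calc _ ≤ ∫⁻ x in Ω, (‖v (Φ 0 x)‖ₑ + ‖v (Φ 1 x)‖ₑ) := lintegral_mono fun x => enorm_sub_le
        _ = (∫⁻ x in Ω, ‖v (Φ 0 x)‖ₑ) + ∫⁻ x in Ω, ‖v (Φ 1 x)‖ₑ :=
          lintegral_add_left'
            (integrable_comp_of_map_le (hmeas 0 h0) (hpush 0 h0) hv).1.enorm _
        _ ≤ 0 + 0 := add_le_add (hle 0 h0) (hle 1 h1)
        _ ≤ _ := by simp
    · rw [mul_right_comm, ENNReal.mul_top h]
      exact le_top
  · lift L to ℝ≥0 using hL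
    refine (lintegral_enorm_comp_sub_comp_le hΩ hv hmaps hmeas hdiff hpush hspeed).trans ?_
    gcongr
    exact le_add_self

/-! ### From snapshots to interpolation errors -/

theorem eLpNorm_interpolant_sub_le {d : ℕ} {Ω : Set (EuclideanSpace ℝ (Fin N))}
    {P : Set (Fin d → ℝ)} {Pn : Finset (Fin d → ℝ)}
    {ℓ : (Fin d → ℝ) → MvPolynomial (Fin d) ℝ}
    {u : (Fin d → ℝ) → EuclideanSpace ℝ (Fin N) → ℝ}
    {φ ψ : (Fin d → ℝ) → (Fin d → ℝ) → EuclideanSpace ℝ (Fin N) → EuclideanSpace ℝ (Fin N)}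
    {μ : Fin d → ℝ} (hμ : μ ∈ P) {R : ℝ≥0∞}
    (hφ : ∀ η ∈ Pn, IntegrableOn (fun x => u η (φ μ η x)) Ω)
    (hψ : ∀ η ∈ Pn, IntegrableOn (fun x => u η (ψ μ η x)) Ω)
    (h : ∀ η ∈ Pn, ∫⁻ x in Ω, ‖u η (φ μ η x) - u η (ψ μ η x)‖ₑ ≤ R) :
    eLpNorm (fun x => interpolant Pn ℓ u φ μ x - interpolant Pn ℓ u ψ μ x) 1
      (volume.restrict Ω) ≤ lebesgueConstant P Pn ℓ * R := by
  simp only [interpolant, ← Finset.sum_sub_distrib, ← mul_sub]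
  rw [eLpNorm_one_eq_lintegral_enorm]
  calc _ ≤ ∫⁻ x in Ω, ∑ η ∈ Pn,
        ‖MvPolynomial.eval μ (ℓ η) * (u η (φ μ η x) - u η (ψ μ η x))‖ₑ :=
      lintegral_mono fun x => enorm_sum_le _ _
    _ = ∑ η ∈ Pn, ∫⁻ x in Ω, ‖MvPolynomial.eval μ (ℓ η) * (u η (φ μ η x) - u η (ψ μ η x))‖ₑ :=
      lintegral_finsetSum' _ fun η hη =>
        (((hφ η hη).sub (hψ η hη)).const_mul (MvPolynomial.eval μ (ℓ η))).1.enorm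
    _ ≤ ∑ η ∈ Pn, ENNReal.ofReal |MvPolynomial.eval μ (ℓ η)| * R := by
      refine Finset.sum_le_sum fun η hη => ?_
      simp only [enorm_mul]
      rw [lintegral_const_mul' _ _ enorm_ne_top, ← Real.enorm_eq_ofReal_abs]
      gcongr
      exact h η hη
    _ = ENNReal.ofReal (∑ η ∈ Pn, |MvPolynomial.eval μ (ℓ η)|) * R := by
      rw [← Finset.sum_mul, ENNReal.ofReal_sum_of_nonneg fun _ _ => abs_nonneg _]
    _ ≤ _ := by
      gcongr
      exact le_iSup₂_of_le μ hμ le_rfl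

theorem memLp_sub_interpolant {d : ℕ} {Ω : Set (EuclideanSpace ℝ (Fin N))}
    {Pn : Finset (Fin d → ℝ)} (ℓ : (Fin d → ℝ) → MvPolynomial (Fin d) ℝ)
    {u : (Fin d → ℝ) → EuclideanSpace ℝ (Fin N) → ℝ}
    {φ : (Fin d → ℝ) → (Fin d → ℝ) → EuclideanSpace ℝ (Fin N) → EuclideanSpace ℝ (Fin N)}
    {μ : Fin d → ℝ} (hu : IntegrableOn (u μ) Ω)
    (hφ : ∀ η ∈ Pn, IntegrableOn (fun x => u η (φ μ η x)) Ω) :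
    MemLp (fun x => u μ x - interpolant Pn ℓ u φ μ x) 1 (volume.restrict Ω) :=
  memLp_one_iff_integrable.2
    (hu.sub (integrable_finsetSum _ fun η hη => (hφ η hη).const_mul _))

theorem trainingError_lt_top {d : ℕ} {Ω : Set (EuclideanSpace ℝ (Fin N))}
    {Pn T : Finset (Fin d → ℝ)} (ℓ : (Fin d → ℝ) → MvPolynomial (Fin d) ℝ)
    {u : (Fin d → ℝ) → EuclideanSpace ℝ (Fin N) → ℝ}
    {φ : (Fin d → ℝ) → (Fin d → ℝ) → EuclideanSpace ℝ (Fin N) → EuclideanSpace ℝ (Fin N)}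
    (hu : ∀ μ ∈ T, IntegrableOn (u μ) Ω)
    (hφ : ∀ μ ∈ T, ∀ η ∈ Pn, IntegrableOn (fun x => u η (φ μ η x)) Ω) :
    trainingError Ω Pn T ℓ u φ < ∞ := by
  rw [trainingError, ← Finset.sup_eq_iSup, Finset.sup_lt_iff ENNReal.zero_lt_top]
  exact fun μ hμ => (memLp_sub_interpolant ℓ (hu μ hμ) (hφ μ hμ)).2

theorem trainingError_le_add {d : ℕ} {Ω : Set (EuclideanSpace ℝ (Fin N))}
    {Pn T : Finset (Fin d → ℝ)} (ℓ : (Fin d → ℝ) → MvPolynomial (Fin d) ℝ)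
    {u : (Fin d → ℝ) → EuclideanSpace ℝ (Fin N) → ℝ}
    {φ ψ : (Fin d → ℝ) → (Fin d → ℝ) → EuclideanSpace ℝ (Fin N) → EuclideanSpace ℝ (Fin N)}
    (hu : ∀ μ ∈ T, IntegrableOn (u μ) Ω)
    (hφ : ∀ μ ∈ T, ∀ η ∈ Pn, IntegrableOn (fun x => u η (φ μ η x)) Ω)
    (hψ : ∀ μ ∈ T, ∀ η ∈ Pn, IntegrableOn (fun x => u η (ψ μ η x)) Ω) {R : ℝ≥0∞}
    (h : ∀ μ ∈ T, eLpNorm (fun x => interpolant Pn ℓ u φ μ x - interpolant Pn ℓ u ψ μ x) 1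
      (volume.restrict Ω) ≤ R) :
    trainingError Ω Pn T ℓ u φ ≤ trainingError Ω Pn T ℓ u ψ + R := by
  refine iSup₂_le fun μ hμ => ?_
  have h1 := memLp_sub_interpolant ℓ (hu μ hμ) (hφ μ hμ)
  have h2 := memLp_sub_interpolant ℓ (hu μ hμ) (hψ μ hμ)
  have h3 : (fun x => interpolant Pn ℓ u φ μ x - interpolant Pn ℓ u ψ μ x)
      = (fun x => u μ x - interpolant Pn ℓ u ψ μ x)
        - fun x => u μ x - interpolant Pn ℓ u φ μ x := by
    ext x
    simp
  have h4 := h μ hμ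
  rw [h3, eLpNorm_sub_comm] at h4
  calc _ = eLpNorm ((fun x => u μ x - interpolant Pn ℓ u ψ μ x)
          + ((fun x => u μ x - interpolant Pn ℓ u φ μ x)
            - fun x => u μ x - interpolant Pn ℓ u ψ μ x)) 1 (volume.restrict Ω) := by
        rw [add_sub_cancel]
    _ ≤ _ := eLpNorm_add_le h2.1 (h1.sub h2).1 le_rfl
    _ ≤ _ := add_le_add (le_iSup₂_of_le μ hμ le_rfl) h4

end SnapshotInterpolation

/-! ### The stability estimate -/

theorem mainTheorem4 {d N : ℕ}
    (Ω : Set (EuclideanSpace ℝ (Fin N))) (hΩ : IsOpen Ω)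
    (P : Set (Fin d → ℝ)) (Pn T : Finset (Fin d → ℝ))
    (hPn : (Pn : Set (Fin d → ℝ)) ⊆ P) (hT : (T : Set (Fin d → ℝ)) ⊆ P)
    (ℓ : (Fin d → ℝ) → MvPolynomial (Fin d) ℝ)
    (hℓ : SnapshotInterpolation.IsLagrangeBasis Pn ℓ)
    (u : (Fin d → ℝ) → EuclideanSpace ℝ (Fin N) → ℝ)
    (hu : ∀ μ ∈ P, SnapshotInterpolation.MemBV Ω (u μ))
    (φ ψ : (Fin d → ℝ) → (Fin d → ℝ) → EuclideanSpace ℝ (Fin N) → EuclideanSpace ℝ (Fin N))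
    (c C : ℝ≥0)
    (Φ : (Fin d → ℝ) → (Fin d → ℝ) → ℝ → EuclideanSpace ℝ (Fin N) → EuclideanSpace ℝ (Fin N))
    (hΦ_maps : ∀ μ ∈ P, ∀ η ∈ Pn, ∀ s ∈ Icc (0 : ℝ) 1, MapsTo (Φ μ η s) Ω Ω)
    (hΦ_meas : ∀ μ ∈ P, ∀ η ∈ Pn, ∀ s ∈ Icc (0 : ℝ) 1,
      AEMeasurable (Φ μ η s) (volume.restrict Ω))
    (hΦ_diff : ∀ μ ∈ P, ∀ η ∈ Pn, ∀ x ∈ Ω,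
      DifferentiableOn ℝ (fun s => Φ μ η s x) (Icc (0 : ℝ) 1))
    (hΦ_zero : ∀ μ ∈ P, ∀ η ∈ Pn, ∀ x ∈ Ω, Φ μ η 0 x = φ μ η x)
    (hΦ_one : ∀ μ ∈ P, ∀ η ∈ Pn, ∀ x ∈ Ω, Φ μ η 1 x = ψ μ η x)
    (hΦ_push : ∀ μ ∈ P, ∀ η ∈ Pn, ∀ s ∈ Icc (0 : ℝ) 1,
      ∀ A : Set (EuclideanSpace ℝ (Fin N)), A ⊆ Ω → NullMeasurableSet A →
        volume (Ω ∩ Φ μ η s ⁻¹' A) ≤ c * volume A)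
    (hΦ_speed : ∀ μ ∈ P, ∀ η ∈ Pn,
      (⨆ s ∈ Icc (0 : ℝ) 1, ⨆ x ∈ Ω,
          ‖derivWithin (fun t => Φ μ η t x) (Icc (0 : ℝ) 1) s‖ₑ)
        ≤ C * SnapshotInterpolation.supNorm Ω (fun x => φ μ η x - ψ μ η x)) :
    SnapshotInterpolation.trainingError Ω Pn T ℓ u φ < ∞ ∧
    SnapshotInterpolation.trainingError Ω Pn T ℓ u ψ < ∞ ∧
    ENNReal.ofReal |(SnapshotInterpolation.trainingError Ω Pn T ℓ u φ).toReal
        - (SnapshotInterpolation.trainingError Ω Pn T ℓ u ψ).toReal|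
      ≤ c * C * SnapshotInterpolation.lebesgueConstant P Pn ℓ
          * (⨆ η ∈ Pn, SnapshotInterpolation.bvNorm Ω (u η))
          * (⨆ μ ∈ P, ⨆ η ∈ Pn,
              SnapshotInterpolation.supNorm Ω (fun x => φ μ η x - ψ μ η x)) := by
  have h0 : (0 : ℝ) ∈ Icc (0 : ℝ) 1 := left_mem_Icc.2 zero_le_one
  have h1 : (1 : ℝ) ∈ Icc (0 : ℝ) 1 := right_mem_Icc.2 zero_le_one
  have hpush : ∀ μ ∈ P, ∀ η ∈ Pn, ∀ s ∈ Icc (0 : ℝ) 1,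
      (volume.restrict Ω).map (Φ μ η s) ≤ c • volume.restrict Ω := fun μ hμ η hη s hs =>
    SnapshotInterpolation.map_restrict_le hΩ.measurableSet (hΦ_meas μ hμ η hη s hs)
      (hΦ_maps μ hμ η hη s hs) (hΦ_push μ hμ η hη s hs)
  have hint : ∀ μ ∈ P, ∀ η ∈ Pn, ∀ s ∈ Icc (0 : ℝ) 1,
      IntegrableOn (fun x => u η (Φ μ η s x)) Ω := fun μ hμ η hη s hs =>
    SnapshotInterpolation.integrable_comp_of_map_le (hΦ_meas μ hμ η hη s hs)
      (hpush μ hμ η hη s hs) (hu η (hPn hη)).1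
  have hφ : ∀ μ ∈ T, ∀ η ∈ Pn, IntegrableOn (fun x => u η (φ μ η x)) Ω := fun μ hμ η hη =>
    (hint μ (hT hμ) η hη 0 h0).congr_fun
      (fun x hx => by simp only [hΦ_zero μ (hT hμ) η hη x hx]) hΩ.measurableSet
  have hψ : ∀ μ ∈ T, ∀ η ∈ Pn, IntegrableOn (fun x => u η (ψ μ η x)) Ω := fun μ hμ η hη =>
    (hint μ (hT hμ) η hη 1 h1).congr_fun
      (fun x hx => by simp only [hΦ_one μ (hT hμ) η hη x hx]) hΩ.measurableSet
  have huT : ∀ μ ∈ T, IntegrableOn (u μ) Ω := fun μ hμ => (hu μ (hT hμ)).1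
  set B : ℝ≥0∞ := ⨆ η ∈ Pn, SnapshotInterpolation.bvNorm Ω (u η)
  set S : ℝ≥0∞ := ⨆ μ ∈ P, ⨆ η ∈ Pn,
    SnapshotInterpolation.supNorm Ω (fun x => φ μ η x - ψ μ η x)
  have hpair : ∀ μ ∈ T, ∀ η ∈ Pn,
      ∫⁻ x in Ω, ‖u η (φ μ η x) - u η (ψ μ η x)‖ₑ ≤ c * (C * S) * B := by
    intro μ hμ η hη
    have hμP := hT hμ
    have hS : SnapshotInterpolation.supNorm Ω (fun x => φ μ η x - ψ μ η x) ≤ S :=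
      le_iSup₂_of_le μ hμP (le_iSup₂_of_le η hη le_rfl)
    have hB : SnapshotInterpolation.bvNorm Ω (u η) ≤ B := le_iSup₂_of_le η hη le_rfl
    calc _ = ∫⁻ x in Ω, ‖u η (Φ μ η 0 x) - u η (Φ μ η 1 x)‖ₑ :=
          setLIntegral_congr_fun hΩ.measurableSet fun x hx => by
            simp only [hΦ_zero μ hμP η hη x hx, hΦ_one μ hμP η hη x hx]
      _ ≤ _ := SnapshotInterpolation.lintegral_enorm_comp_sub_comp_le_bvNorm hΩ
          (hu η (hPn hη)).1 (hΦ_maps μ hμP η hη) (hΦ_meas μ hμP η hη) (hΦ_diff μ hμP η hη)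
          (hpush μ hμP η hη) fun s hs x hx => (le_iSup₂_of_le s hs (le_iSup₂ (f := fun x
            (_ : x ∈ Ω) => ‖derivWithin (fun t => Φ μ η t x) (Icc (0 : ℝ) 1) s‖ₑ) x hx)).trans
            (hΦ_speed μ hμP η hη)
      _ ≤ _ := by gcongr
  have hR : c * C * SnapshotInterpolation.lebesgueConstant P Pn ℓ * B * S
      = SnapshotInterpolation.lebesgueConstant P Pn ℓ * (c * (C * S) * B) := by ring
  have hφT := SnapshotInterpolation.trainingError_lt_top ℓ huT hφ
  have hψT := SnapshotInterpolation.trainingError_lt_top ℓ huT hψ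
  refine ⟨hφT, hψT, ?_⟩
  rw [hR]
  refine SnapshotInterpolation.ofReal_abs_toReal_sub_toReal_le hφT.ne hψT.ne
    (SnapshotInterpolation.trainingError_le_add ℓ huT hφ hψ fun μ hμ => ?_)
    (SnapshotInterpolation.trainingError_le_add ℓ huT hψ hφ fun μ hμ => ?_)
  · exact SnapshotInterpolation.eLpNorm_interpolant_sub_le (hT hμ) (hφ μ hμ) (hψ μ hμ)
      (hpair μ hμ)
  · exact SnapshotInterpolation.eLpNorm_interpolant_sub_le (hT hμ) (hψ μ hμ) (hφ μ hμ)
      fun η hη => by simpa only [enorm_sub_rev] using hpair μ hμ η hη
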